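/- For a finite simple graph $G=(V,E)$ let $d_G$ be the graph distance, $N^k[v]=\{w\in V: d_G(v,w)\le k\}$, call $D\subseteq V$ a distance-$k$ dominating set if every $v\in V$ has $N^k[v]\cap D\neq\emptyset$, and let $\gamma_k(G)$ be the minimum size of such a set. Let the vertices carry distinct identifiers $ID(v)\in\mathbb{N}$. The algorithm DomSet (with parameter $k$) is the following: every vertex $v$ computes $q_v=|N^k[v]|$; then every $v$ selects the vertex $w_v\in N^k[v]$ for which $q_{w_v}$ is maximum and, subject to this, $ID(w_v)$ is maximum; the output is $D=\{w_v : v\in V\}$. In the LOCAL model the vertices are processors that initially know only their own identifier (and $k$); in each synchronous round every vertex exchanges messages of arbitrary size with its neighbours and performs arbitrary local computation. **Theorem.** There are an absolute constant $c$ and a LOCAL implementation of DomSet (depending on $k$ only) such that for all integers $t,k\ge 1$ there is a constant $\delta=\delta(t,k)$ with the following property. For every finite connected graph $G$ with no $K_{2,t}$-minor and with $\operatorname{diam}(G)\ge 4k$, and every assignment of distinct identifiers, DomSet finishes within $ck$ rounds, every vertex $v$ then knowing $q_v$, $ID(w_v)$ and whether $v\in D$, and its output $D$ is a distance-$k$ dominating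 set of $G$ with $|D|\le\delta\cdot\gamma_k(G)$. -/

import Mathlib

universe u

namespace DistDom

section Graph

variable {V : Type u}

/-- `H` is a minor of `G`: for some subgraph `G'` of `G`, the vertices of `G'` can be partitioned
into classes (the fibres of `f`, indexed by the vertices of `H`), each inducing a connected
subgraph of `G'`, such that contracting each class to a vertex, and discarding loops and parallel
edges, gives `H`. -/
def IsMinor {W : Type*} (H : SimpleGraph W) (G : SimpleGraph V) : Prop :=
  ∃ (G' : G.Subgraph) (f : G'.verts → W),
    (∀ a : W, (G'.coe.induce (f ⁻¹' {a})).Connected) ∧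
    ∀ a b : W, H.Adj a b ↔ a ≠ b ∧ ∃ x y : G'.verts, f x = a ∧ f y = b ∧ G'.coe.Adj x y

/-- The closed ball `N^k[v]`. -/
def nbhd (G : SimpleGraph V) (k : ℕ) (v : V) : Set V :=
  {w | G.edist v w ≤ k}

/-- `D` is a distance-`k` dominating set of `G`. -/
def IsDistDominating (G : SimpleGraph V) (k : ℕ) (D : Set V) : Prop :=
  ∀ v, ∃ w ∈ D, w ∈ nbhd G k v

/-- `γ_k(G)`, the size of a smallest distance-`k` dominating set (for finite `G`). -/
noncomputable def distDomNumber (G : SimpleGraph V) (k : ℕ) : ℕ :=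
  sInf {n | ∃ D : Set V, IsDistDominating G k D ∧ D.ncard = n}

/-- `q_v = |N^k[v]|`. -/
noncomputable def ballCard (G : SimpleGraph V) (k : ℕ) (v : V) : ℕ :=
  (nbhd G k v).ncard

/-- `w = w_v`: `w` is the vertex of `N^k[v]` with `q_w` maximum and, subject to this, with
`ID w` maximum. -/
def Selects (G : SimpleGraph V) (ID : V → ℕ) (k : ℕ) (v w : V) : Prop :=
  w ∈ nbhd G k v ∧ ∀ x ∈ nbhd G k v,
    ballCard G k x < ballCard G k w ∨ (ballCard G k x = ballCard G k w ∧ ID x ≤ ID w)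

/-- On a finite graph with unique identifiers, `w_v` is well defined. -/
theorem existsUnique_selects [Finite V] (G : SimpleGraph V) (ID : V → ℕ)
    (hID : Function.Injective ID) (k : ℕ) (v : V) : ∃! w, Selects G ID k v w := by
  have hne : (nbhd G k v).Nonempty := ⟨v, by simp [nbhd]⟩
  obtain ⟨w, hw, hmax⟩ := Set.exists_max_image (nbhd G k v)
    (fun x => toLex (ballCard G k x, ID x)) (Set.toFinite _) hne
  refine ⟨w, ⟨hw, fun x hx => ?_⟩, ?_⟩
  · simpa [Prod.Lex.toLex_le_toLex] using hmax x hx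
  · rintro y ⟨hy, hymax⟩
    have h1 := hymax w hw
    have h2 := hmax y hy
    simp only [Prod.Lex.toLex_le_toLex] at h2
    apply hID
    omega

/-- The set `D = ⋃ {w_v}` returned by the algorithm DomSet. -/
def domSet (G : SimpleGraph V) (ID : V → ℕ) (k : ℕ) : Set V :=
  {w | ∃ v, Selects G ID k v w}

end Graph

/-- A deterministic algorithm in the LOCAL model. Initially a vertex knows only its own
identifier. In each synchronous round it sends a message of unbounded size to each neighbour
(possibly different ones, addressed by identifier), receives the messages of its neighbours
labelled by the identifiers of their senders, and updates its state by an arbitrary local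
computation. A vertex announces its output by `output` becoming different from `none`. -/
structure LocalAlgorithm (Out : Type) where
  State : Type
  Msg : Type
  init : ℕ → State
  send : State → ℕ → Msg
  receive : State → Set (ℕ × Msg) → State
  output : State → Option Out

namespace LocalAlgorithm

variable {Out : Type} {V : Type u}

/-- The state of each vertex after a given number of rounds on the network `G`. -/
def run (A : LocalAlgorithm Out) (G : SimpleGraph V) (ID : V → ℕ) : ℕ → V → A.State
  | 0, v => A.init (ID v)
  | r + 1, v => A.receive (A.run G ID r v)
      {m | ∃ x, G.Adj v x ∧ m = (ID x, A.send (A.run G ID r x) (ID v))}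

/-- Within `T` rounds every vertex `v` announces an output, and the first output `o` it announces
satisfies `P v o`. -/
def SolvesWithin (A : LocalAlgorithm Out) (G : SimpleGraph V) (ID : V → ℕ) (T : ℕ)
    (P : V → Out → Prop) : Prop :=
  ∀ v, ∃ r ≤ T, (∀ s < r, A.output (A.run G ID s v) = none) ∧
    ∃ o, A.output (A.run G ID r v) = some o ∧ P v o

end LocalAlgorithm

/-- What a vertex `v` has computed at the end of DomSet: the number `q_v`, the identifier of
`w_v`, and whether `v` itself belongs to `D`. -/
structure DomSetOutput where
  q : ℕ
  selected : ℕ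
  inD : Bool

/-- `o` is the correct result of the steps of DomSet at the vertex `v`. -/
def IsDomSetOutput {V : Type u} (G : SimpleGraph V) (ID : V → ℕ) (k : ℕ) (v : V)
    (o : DomSetOutput) : Prop :=
  o.q = ballCard G k v ∧ (∃ w, Selects G ID k v w ∧ o.selected = ID w) ∧
    (o.inD = true ↔ v ∈ domSet G ID k)

end DistDom

/-! Fix a minimum distance-`k` dominating set `M` and its shortest path forest: every vertex hangs
at depth at most `k` below a root in `M`, and the trees (cells) partition `V`. The approximation
bound follows from a small core `R` of vertices such that every ball `N^k[w]` lies in a ball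
`N^k[z]` with `z ∈ R`. If `w` is selected by some `v`, such a `z` also lies in `N^k[v]`, so
maximality of `q_w` forces the two balls to coincide. Selected vertices with equal balls are
candidates for each other's selectors, so the identifier tie-break makes them equal. Hence `w ↦ z`
is injective on `D` and `|D| ≤ |R|`.

To build `R`, start with the roots and pass from a core vertex `z` to those children `c` from whose
subtree the outside of the subtree of `z` might be reached within `k` steps without using `z`, by
crossing edges between sibling subtrees (`NearExit`). If `w` lies below a child `c` that is not of
this kind, a walk of length at most `k` from `w` either ends below `z`, hence within distance `k` of
`z`, or meets `z`; so `N^k[w] ⊆ N^k[z]` (`exists_core_nbhd_subset`).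

The core is small because fewer than `t` children of `z` have subtrees touching a given connected
set that avoids `z` and these subtrees: together with `{z}` they would give a `K_{2,t}`-minor
(`card_children_lt`). This bounds the exits inside a cell and the links between siblings. Exits to
other cells are counted from the linear edge bound for the graph of contracted cells
(`card_adjFibres_le`).

Locally, membership of `v` in `D` depends on selectors at distance at most `k`, their candidates at
distance at most `2k`, and the balls of these, so flooding for `3k` rounds suffices. -/

namespace DistDom

/-! ### Minor models and the linear edge bound -/

section Minor

variable {V : Type u} {W : Type*}

/-- `A` and `B` are joined by an edge of `G`. -/
def Touches (G : SimpleGraph V) (A B : Set V) : Prop :=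
  ∃ x ∈ A, ∃ y ∈ B, G.Adj x y

theorem Touches.symm {G : SimpleGraph V} {A B : Set V} (h : Touches G A B) : Touches G B A := by
  obtain ⟨x, hx, y, hy, hxy⟩ := h
  exact ⟨y, hy, x, hx, hxy.symm⟩

/-- A minor model: disjoint connected branch sets, the fibres of a partial map, that are joined
by an edge whenever the corresponding vertices of `H` are adjacent. -/
theorem isMinor_of_branchSets {H : SimpleGraph W} {G : SimpleGraph V} (g : V → Option W)
    (hconn : ∀ a, (G.induce {v | g v = some a}).Connected)
    (hadj : ∀ a b, H.Adj a b → Touches G {v | g v = some a} {v | g v = some b}) :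
    IsMinor H G := by
  let G' : G.Subgraph :=
    { verts := {v | (g v).isSome}
      -- Edges between branch sets of non-adjacent vertices of `H` are deleted, since `IsMinor`
      -- demands an equivalence of adjacencies.
      Adj := fun x y => G.Adj x y ∧ ∃ a b, g x = some a ∧ g y = some b ∧ (a = b ∨ H.Adj a b)
      adj_sub := fun h => h.1
      edge_vert := by
        rintro x y ⟨-, a, b, ha, -⟩
        simp [ha]
      symm := ⟨by
        rintro x y ⟨h, a, b, ha, hb, hab⟩
        exact ⟨h.symm, b, a, hb, ha, hab.imp Eq.symm SimpleGraph.Adj.symm⟩⟩ }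
  have hf : ∀ (x : G'.verts) a, (g x).get x.2 = a ↔ g x = some a := by
    intro x a
    exact ⟨by rintro rfl; simp, fun h => by simp [h]⟩
  refine ⟨G', fun x => (g x).get x.2, fun a => ?_, fun a b => ⟨fun h => ⟨h.ne, ?_⟩, ?_⟩⟩
  · let φ : G.induce {v | g v = some a} →g
        G'.coe.induce ((fun x : G'.verts => (g x).get x.2) ⁻¹' {a}) :=
      { toFun := fun v => ⟨⟨v.1, by
          have h := v.2
          simp only [Set.mem_ofPred_eq] at h
          simp [G', h]⟩, by
          have h := v.2
          simp only [Set.mem_ofPred_eq] at h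
          simp [h]⟩
        map_rel' := by
          intro x y h
          exact ⟨h, a, a, x.2, y.2, Or.inl rfl⟩ }
    refine (hconn a).map φ ?_
    rintro ⟨x, hx⟩
    exact ⟨⟨x.1, (hf x a).1 hx⟩, rfl⟩
  · obtain ⟨x, hx, y, hy, hxy⟩ := hadj a b h
    simp only [Set.mem_ofPred_eq] at hx hy
    exact ⟨⟨x, by simp [G', hx]⟩, ⟨y, by simp [G', hy]⟩, (hf _ _).2 hx, (hf _ _).2 hy,
      hxy, a, b, hx, hy, Or.inr h⟩
  · rintro ⟨hne, x, y, hx, hy, -, a', b', ha', hb', h⟩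
    rw [hf] at hx hy
    obtain rfl : a = a' := by simpa [hx] using ha'
    obtain rfl : b = b' := by simpa [hy] using hb'
    exact h.resolve_left hne

/-- If `G` has no `K_{2,t}`-minor then fewer than `t` disjoint connected sets touch both of two
disjoint connected sets. -/
theorem card_lt_of_not_isMinor {G : SimpleGraph V} {t : ℕ}
    (hG : ¬ IsMinor (completeBipartiteGraph (Fin 2) (Fin t)) G)
    {A B : Set V} (hA : (G.induce A).Connected) (hB : (G.induce B).Connected)
    (hAB : Disjoint A B) {ι : Type*} (C : ι → Set V) (I : Finset ι)
    (hC : ∀ i ∈ I, (G.induce (C i)).Connected)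
    (hCC : ∀ i ∈ I, ∀ j ∈ I, i ≠ j → Disjoint (C i) (C j))
    (hCA : ∀ i ∈ I, Disjoint (C i) A) (hCB : ∀ i ∈ I, Disjoint (C i) B)
    (hTA : ∀ i ∈ I, Touches G (C i) A) (hTB : ∀ i ∈ I, Touches G (C i) B) :
    I.card < t := by
  classical
  by_contra! hcard
  apply hG
  obtain ⟨e, he⟩ : ∃ e : Fin t → ι, Function.Injective e ∧ ∀ i, e i ∈ I := by
    obtain ⟨J, hJI, hJ⟩ := Finset.exists_subset_card_eq hcard
    exact ⟨fun i => (J.equivFinOfCardEq hJ).symm i,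
      Subtype.val_injective.comp (Equiv.injective _), fun i => hJI (Subtype.prop _)⟩
  obtain ⟨he, heI⟩ := he
  let S : Fin 2 ⊕ Fin t → Set V := Sum.elim ![A, B] (fun i => C (e i))
  have hdisj : ∀ a b v, v ∈ S a → v ∈ S b → a = b := by
    have key : ∀ a b, a ≠ b → Disjoint (S a) (S b) := by
      rintro (a | a) (b | b) hab
      · fin_cases a <;> fin_cases b <;> simp_all [S, hAB.symm]
      · fin_cases a
        · exact (hCA _ (heI b)).symm
        · exact (hCB _ (heI b)).symm
      · fin_cases b
        · exact hCA _ (heI a)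
        · exact hCB _ (heI a)
      · exact hCC _ (heI a) _ (heI b) fun h => hab (congrArg _ (he h))
    intro a b v ha hb
    by_contra hab
    exact Set.disjoint_left.1 (key a b hab) ha hb
  let g : V → Option (Fin 2 ⊕ Fin t) := fun v =>
    if h : ∃ a, v ∈ S a then some h.choose else none
  have hg : ∀ a, {v | g v = some a} = S a := by
    intro a
    ext v
    simp only [Set.mem_ofPred_eq, g]
    constructor
    · intro h
      split_ifs at h with h'
      have := h'.choose_spec
      rwa [Option.some.inj h] at this
    · intro h
      have h' : ∃ a, v ∈ S a := ⟨a, h⟩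
      rw [dif_pos h', hdisj _ _ v h'.choose_spec h]
  have hCT : ∀ i b, Touches G (S (Sum.inr i)) (S (Sum.inl b)) := by
    intro i b
    fin_cases b
    · exact hTA _ (heI i)
    · exact hTB _ (heI i)
  refine isMinor_of_branchSets g (fun a => ?_) (fun a b hab => ?_)
  · rw [hg]
    rcases a with a | a
    · fin_cases a
      · exact hA
      · exact hB
    · exact hC _ (heI a)
  · rw [hg, hg]
    rcases a with a | a <;> rcases b with b | b <;> simp at hab
    · exact (hCT b a).symm
    · exact hCT a b

theorem induce_union_connected_of_touches {G : SimpleGraph V} {A B : Set V}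
    (hA : (G.induce A).Connected) (hB : (G.induce B).Connected) (h : Touches G A B) :
    (G.induce (A ∪ B)).Connected := by
  obtain ⟨x, hx, y, hy, hxy⟩ := h
  have h1 := SimpleGraph.induce_union_connected hA.preconnected
    (SimpleGraph.induce_pair_connected_of_adj hxy).preconnected ⟨x, hx, by simp⟩
  have h2 := SimpleGraph.induce_union_connected h1.preconnected hB.preconnected
    ⟨y, by simp, hy⟩
  convert h2 using 2 <;>
  · ext v
    simp only [Set.mem_union, Set.mem_insert_iff, Set.mem_singleton_iff]
    grind

theorem induce_singleton_connected (G : SimpleGraph V) (z : V) :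
    (G.induce {z}).Connected := by
  rw [SimpleGraph.connected_iff_exists_forall_reachable]
  refine ⟨⟨z, rfl⟩, ?_⟩
  rintro ⟨w, rfl⟩
  rfl

/-- Ordered pairs of distinct fibres of `f` that are joined by an edge. -/
noncomputable def adjFibres [Fintype V] (G : SimpleGraph V) (f : V → V) : Finset (V × V) := by
  classical exact Finset.univ.filter fun e => e.1 ≠ e.2 ∧ Touches G (f ⁻¹' {e.1}) (f ⁻¹' {e.2})

theorem mem_adjFibres [Fintype V] {G : SimpleGraph V} {f : V → V} {a b : V} :
    (a, b) ∈ adjFibres G f ↔ a ≠ b ∧ Touches G (f ⁻¹' {a}) (f ⁻¹' {b}) := by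
  simp [adjFibres]

theorem mem_adjFibres_comm [Fintype V] {G : SimpleGraph V} {f : V → V} {a b : V} :
    (a, b) ∈ adjFibres G f ↔ (b, a) ∈ adjFibres G f := by
  rw [mem_adjFibres, mem_adjFibres]
  exact ⟨fun h => ⟨h.1.symm, h.2.symm⟩, fun h => ⟨h.1.symm, h.2.symm⟩⟩

open Classical in
/-- Contracting one edge of a graph with no `K_{2,t}`-minor destroys at most `t` edges. -/
theorem card_adjFibres_le_of_contract [Fintype V] {G : SimpleGraph V} {t : ℕ}
    (hG : ¬ IsMinor (completeBipartiteGraph (Fin 2) (Fin t)) G) (f : V → V)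
    (hf : ∀ v, (G.induce (f ⁻¹' {f v})).Connected) {a b : V} (hab : (a, b) ∈ adjFibres G f) :
    (adjFibres G f).card ≤
      (adjFibres G fun v => if f v = b then a else f v).card + 2 * t := by
  set f' : V → V := fun v => if f v = b then a else f v with hf'
  obtain ⟨hne, hT⟩ := mem_adjFibres.1 hab
  have hconn : ∀ x y, (x, y) ∈ adjFibres G f → (G.induce (f ⁻¹' {x})).Connected := by
    intro x y h
    obtain ⟨-, v, rfl, -⟩ := mem_adjFibres.1 h
    exact hf v
  let Nb : Finset V := Finset.univ.filter fun c => (c, b) ∈ adjFibres G f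
  let Na : Finset V := Finset.univ.filter fun c => (c, a) ∈ adjFibres G f
  let Q : Finset (V × V) := (adjFibres G f).filter fun e => e.1 ≠ b ∧ e.2 ≠ b
  have hmemb : ∀ c, c ∈ Nb ↔ (c, b) ∈ adjFibres G f := fun c => by simp [Nb]
  have hmema : ∀ c, c ∈ Na ↔ (c, a) ∈ adjFibres G f := fun c => by simp [Na]
  have hsub : ∀ x y, (x, y) ∈ adjFibres G f → x ≠ b → y ≠ b → (x, y) ∈ adjFibres G f' := by
    intro x y h hx hy
    obtain ⟨h1, v, rfl, w, rfl, hvw⟩ := mem_adjFibres.1 h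
    exact mem_adjFibres.2 ⟨h1, v, by simp [hf', hx], w, by simp [hf', hy], hvw⟩
  have hsub' : ∀ c, c ∈ Nb → c ≠ a → (c, a) ∈ adjFibres G f' := by
    intro c hc hca
    obtain ⟨h1, v, hv, w, hw, hvw⟩ := mem_adjFibres.1 ((hmemb c).1 hc)
    simp only [Set.mem_preimage, Set.mem_singleton_iff] at hv hw
    exact mem_adjFibres.2 ⟨hca, v, by simp [hf', hv, h1], w, by simp [hf', hw], hvw⟩
  -- The fibres over common neighbours form the `t`-side of a `K_{2,t}` whose other side is the
  -- fibres over `a` and `b`.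
  have hcommon : (Nb ∩ Na).card < t := by
    refine card_lt_of_not_isMinor hG (hconn a b hab) (hconn b a (mem_adjFibres_comm.1 hab))
      ?_ (fun c => f ⁻¹' {c}) (Nb ∩ Na) ?_ ?_ ?_ ?_ ?_ ?_
    · exact Disjoint.preimage _ (by simpa using hne)
    · intro c hc
      exact hconn c b ((hmemb c).1 (Finset.mem_inter.1 hc).1)
    · intro c _ c' _ h
      exact Disjoint.preimage _ (by simpa using h)
    · intro c hc
      have h := (mem_adjFibres.1 ((hmema c).1 (Finset.mem_inter.1 hc).2)).1
      exact Disjoint.preimage _ (by simpa using h)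
    · intro c hc
      have h := (mem_adjFibres.1 ((hmemb c).1 (Finset.mem_inter.1 hc).1)).1
      exact Disjoint.preimage _ (by simpa using h)
    · intro c hc
      exact (mem_adjFibres.1 ((hmema c).1 (Finset.mem_inter.1 hc).2)).2
    · intro c hc
      exact (mem_adjFibres.1 ((hmemb c).1 (Finset.mem_inter.1 hc).1)).2
  -- These neighbours of `b` become new neighbours of `a`. What is lost is `a` itself and at most `t
  -- - 1` common neighbours, hence `t` edges, or `2 * t` ordered pairs.
  let N : Finset V := (Nb \ Na).erase a
  have hN : Nb.card ≤ N.card + t := by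
    have h1 : Nb.card = (Nb ∩ Na).card + (Nb \ Na).card := by
      rw [add_comm, Finset.card_sdiff_add_card_inter]
    have h2 : (Nb \ Na).card ≤ N.card + 1 := by
      have : (Nb \ Na).card - 1 ≤ N.card := Finset.pred_card_le_card_erase
      omega
    omega
  have hupper : (adjFibres G f).card ≤ Q.card + 2 * Nb.card := by
    have h : adjFibres G f ⊆ Q ∪ (Nb.image (fun c => (c, b)) ∪ Nb.image (fun c => (b, c))) := by
      rintro ⟨x, y⟩ hxy
      by_cases hx : x = b
      · subst hx
        have := (hmemb y).2 (mem_adjFibres_comm.1 hxy)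
        simp [this]
      by_cases hy : y = b
      · subst hy
        simp [(hmemb x).2 hxy]
      · simp [Q, hxy, hx, hy]
    have h1 := Finset.card_le_card h
    have h2 := Finset.card_union_le Q (Nb.image (fun c => (c, b)) ∪ Nb.image (fun c => (b, c)))
    have h3 := Finset.card_union_le (Nb.image (fun c => (c, b))) (Nb.image (fun c => (b, c)))
    have h4 : (Nb.image (fun c => (c, b))).card ≤ Nb.card := Finset.card_image_le
    have h5 : (Nb.image (fun c => (b, c))).card ≤ Nb.card := Finset.card_image_le
    omega
  have hlower : Q.card + 2 * N.card ≤ (adjFibres G f').card := by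
    have hNmem : ∀ c ∈ N, c ≠ a ∧ c ∈ Nb ∧ (c, a) ∉ adjFibres G f := by
      intro c hc
      simp only [N, Finset.mem_erase, Finset.mem_sdiff, hmema] at hc
      exact ⟨hc.1, hc.2.1, hc.2.2⟩
    have hd1 : Disjoint (N.image (fun c => (c, a))) (N.image (fun c => (a, c))) := by
      rw [Finset.disjoint_left]
      simp only [Finset.mem_image, not_exists, not_and]
      rintro _ ⟨c, hc, rfl⟩ c' hc' h
      exact (hNmem c hc).1 (congrArg Prod.fst h).symm
    have hd2 : Disjoint Q (N.image (fun c => (c, a)) ∪ N.image (fun c => (a, c))) := by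
      rw [Finset.disjoint_right]
      simp only [Finset.mem_union, Finset.mem_image]
      rintro _ (⟨c, hc, rfl⟩ | ⟨c, hc, rfl⟩) h
      · exact (hNmem c hc).2.2 (Finset.mem_filter.1 h).1
      · exact (hNmem c hc).2.2 (mem_adjFibres_comm.1 (Finset.mem_filter.1 h).1)
    have hsubset : Q ∪ (N.image (fun c => (c, a)) ∪ N.image (fun c => (a, c))) ⊆
        adjFibres G f' := by
      intro e he
      simp only [Finset.mem_union, Finset.mem_image] at he
      rcases he with he | ⟨c, hc, rfl⟩ | ⟨c, hc, rfl⟩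
      · obtain ⟨h1, h2, h3⟩ := Finset.mem_filter.1 he
        exact hsub _ _ h1 h2 h3
      · exact hsub' c (hNmem c hc).2.1 (hNmem c hc).1
      · exact mem_adjFibres_comm.1 (hsub' c (hNmem c hc).2.1 (hNmem c hc).1)
    have h := Finset.card_le_card hsubset
    rw [Finset.card_union_of_disjoint hd2, Finset.card_union_of_disjoint hd1,
      Finset.card_image_of_injective _ (fun x y h => congrArg Prod.fst h),
      Finset.card_image_of_injective _ (fun x y h => congrArg Prod.snd h)] at h
    omega
  omega

open Classical in
/-- A graph with no `K_{2,t}`-minor, and hence each of its contractions, has at most `t n` edges,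
where `n` is the number of vertices. -/
theorem card_adjFibres_le [Fintype V] {G : SimpleGraph V} {t : ℕ}
    (hG : ¬ IsMinor (completeBipartiteGraph (Fin 2) (Fin t)) G) (f : V → V)
    (hf : ∀ v, (G.induce (f ⁻¹' {f v})).Connected) :
    (adjFibres G f).card ≤ 2 * t * (Finset.univ.image f).card := by
  obtain ⟨n, hn⟩ : ∃ n, (Finset.univ.image f).card = n := ⟨_, rfl⟩
  induction n generalizing f with
  | zero =>
    have : adjFibres G f = ∅ := by
      rw [Finset.eq_empty_iff_forall_notMem]
      rintro ⟨a, b⟩ hab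
      obtain ⟨-, v, -⟩ := mem_adjFibres.1 hab
      simp only [Finset.card_eq_zero, Finset.image_eq_empty] at hn
      exact absurd (Finset.mem_univ v) (by simp [hn])
    simp [this]
  | succ n ih =>
    rcases (adjFibres G f).eq_empty_or_nonempty with h | ⟨⟨a, b⟩, hab⟩
    · simp [h]
    obtain ⟨hne, hT⟩ := mem_adjFibres.1 hab
    have hstep := card_adjFibres_le_of_contract hG f hf hab
    set f' : V → V := fun v => if f v = b then a else f v with hf'
    have hfa : (G.induce (f ⁻¹' {a})).Connected := by
      obtain ⟨v, rfl, -⟩ := hT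
      exact hf v
    have hfb : (G.induce (f ⁻¹' {b})).Connected := by
      obtain ⟨v, -, w, rfl, -⟩ := hT
      exact hf w
    have hconn : ∀ v, (G.induce (f' ⁻¹' {f' v})).Connected := by
      intro v
      by_cases hv : f' v = a
      · have : f' ⁻¹' {f' v} = f ⁻¹' {a} ∪ f ⁻¹' {b} := by
          ext x
          rw [hv]
          simp only [hf', Set.mem_preimage, Set.mem_singleton_iff, Set.mem_union]
          grind
        rw [this]
        exact induce_union_connected_of_touches hfa hfb hT
      · have : f' ⁻¹' {f' v} = f ⁻¹' {f v} := by
          ext x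
          simp only [hf', Set.mem_preimage, Set.mem_singleton_iff] at hv ⊢
          grind
        rw [this]
        exact hf v
    have himage : Finset.univ.image f' = (Finset.univ.image f).erase b := by
      obtain ⟨v, rfl, w, rfl, -⟩ := hT
      ext x
      simp only [hf', Finset.mem_image, Finset.mem_univ, true_and, Finset.mem_erase]
      grind
    have hcard : (Finset.univ.image f').card = n := by
      obtain ⟨v, -, w, rfl, -⟩ := hT
      rw [himage, Finset.card_erase_of_mem (by simp), hn]
      rfl
    have := ih f' hconn hcard
    rw [hcard] at this
    rw [hn]
    have h2 : 2 * t * (n + 1) = 2 * t * n + 2 * t := by ring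
    omega

end Minor

/-! ### Balls in terms of walks -/

section Ball

variable {V : Type u}

theorem mem_nbhd_iff {G : SimpleGraph V} {k : ℕ} {v w : V} :
    w ∈ nbhd G k v ↔ ∃ p : G.Walk v w, p.length ≤ k := by
  constructor
  · intro h
    have hne : G.edist v w ≠ ⊤ := ne_top_of_le_ne_top (ENat.natCast_ne_top k) h
    obtain ⟨p, hp⟩ := SimpleGraph.exists_walk_of_edist_ne_top hne
    refine ⟨p, ?_⟩
    have h' : G.edist v w ≤ k := h
    rw [← hp] at h'
    exact_mod_cast h'
  · rintro ⟨p, hp⟩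
    exact (SimpleGraph.edist_le p).trans (by exact_mod_cast hp)

theorem mem_nbhd_comm {G : SimpleGraph V} {k : ℕ} {v w : V} :
    w ∈ nbhd G k v ↔ v ∈ nbhd G k w := by
  simp only [nbhd, Set.mem_ofPred_eq, SimpleGraph.edist_comm]

end Ball

/-! ### Rooted forests, subtrees and cells -/

/-- A forest of parent pointers along edges of `G`, of height at most `k`; the roots are the
vertices of depth `0`. -/
structure RootedForest {V : Type u} (G : SimpleGraph V) (k : ℕ) where
  parent : V → V
  depth : V → ℕ
  depth_le : ∀ v, depth v ≤ k
  -- Roots are fixed points, so iterating `parent` exactly `k` times reaches the root from every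
  -- depth.
  parent_root : ∀ v, depth v = 0 → parent v = v
  adj_parent : ∀ v, depth v ≠ 0 → G.Adj v (parent v)
  depth_parent : ∀ v, depth v ≠ 0 → depth (parent v) + 1 = depth v

/-- The shortest path forest of a distance-`k` dominating set. -/
theorem exists_rootedForest {V : Type u} {G : SimpleGraph V} {k : ℕ} {M : Set V}
    (hM : IsDistDominating G k M) : ∃ F : RootedForest G k, ∀ v, F.depth v = 0 → v ∈ M := by
  classical
  have hex : ∀ v, ∃ n, ∃ m ∈ M, ∃ p : G.Walk v m, p.length = n := by
    intro v
    obtain ⟨w, hw, hwv⟩ := hM v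
    obtain ⟨p, -⟩ := mem_nbhd_iff.1 hwv
    exact ⟨_, w, hw, p, rfl⟩
  let d : V → ℕ := fun v => Nat.find (hex v)
  have hle : ∀ v m, m ∈ M → ∀ p : G.Walk v m, d v ≤ p.length := fun v m hm p =>
    Nat.find_min' (hex v) ⟨m, hm, p, rfl⟩
  have hpar : ∀ v, ∃ x, (d v = 0 → x = v) ∧ (d v ≠ 0 → G.Adj v x ∧ d x + 1 = d v) := by
    intro v
    obtain ⟨m, hm, p, hp⟩ := Nat.find_spec (hex v)
    change p.length = d v at hp
    cases p with
    | nil => exact ⟨v, fun _ => rfl, fun h => absurd hp.symm h⟩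
    | @cons _ x _ h q =>
      rw [SimpleGraph.Walk.length_cons] at hp
      refine ⟨x, fun h0 => by omega, fun _ => ⟨h, ?_⟩⟩
      have h1 := hle x m hm q
      obtain ⟨m', hm', q', hq'⟩ := Nat.find_spec (hex x)
      change q'.length = d x at hq'
      have h2 := hle v m' hm' (.cons h q')
      rw [SimpleGraph.Walk.length_cons] at h2
      omega
  choose par hpar0 hpar1 using hpar
  refine ⟨⟨par, d, fun v => ?_, hpar0, fun v hv => (hpar1 v hv).1, fun v hv => (hpar1 v hv).2⟩,
    fun v hv => ?_⟩
  · obtain ⟨w, hw, hwv⟩ := hM v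
    obtain ⟨p, hp⟩ := mem_nbhd_iff.1 hwv
    exact (hle v w hw p).trans hp
  · obtain ⟨m, hm, p, hp⟩ := Nat.find_spec (hex v)
    change d v = 0 at hv
    change p.length = d v at hp
    rw [hv] at hp
    rwa [SimpleGraph.Walk.eq_of_length_eq_zero hp]

namespace RootedForest

variable {V : Type u} {G : SimpleGraph V} {k : ℕ} (F : RootedForest G k)

/-- The set of descendants of `z`. -/
def sub (z : V) : Set V :=
  {x | ∃ i, F.parent^[i] x = z}

/-- The root of the tree containing `v`. -/
def root (v : V) : V :=
  F.parent^[k] v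

theorem depth_parent_eq (v : V) : F.depth (F.parent v) = F.depth v - 1 := by
  by_cases h : F.depth v = 0
  · rw [F.parent_root v h, h]
  · have := F.depth_parent v h
    omega

theorem depth_iterate (i : ℕ) (v : V) : F.depth (F.parent^[i] v) = F.depth v - i := by
  induction i with
  | zero => simp
  | succ i ih =>
    rw [Function.iterate_succ_apply', depth_parent_eq, ih]
    omega

theorem depth_root (v : V) : F.depth (F.root v) = 0 := by
  rw [root, depth_iterate]
  have := F.depth_le v
  omega

theorem root_parent (v : V) : F.root (F.parent v) = F.root v := by
  rw [root, root, ← Function.iterate_succ_apply, Function.iterate_succ_apply']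
  exact F.parent_root _ (F.depth_root v)

theorem root_eq_self {v : V} (h : F.depth v = 0) : F.root v = v :=
  Function.iterate_fixed (F.parent_root v h) k

theorem mem_sub_self (z : V) : z ∈ F.sub z :=
  ⟨0, rfl⟩

theorem mem_sub_root (v : V) : v ∈ F.sub (F.root v) :=
  ⟨k, rfl⟩

theorem mem_sub_of_parent_mem {x z : V} (h : F.parent x ∈ F.sub z) : x ∈ F.sub z := by
  obtain ⟨i, hi⟩ := h
  exact ⟨i + 1, hi⟩

theorem sub_subset_sub_parent (c : V) : F.sub c ⊆ F.sub (F.parent c) := by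
  rintro x ⟨i, rfl⟩
  exact ⟨i + 1, Function.iterate_succ_apply' _ _ _⟩

theorem parent_mem_sub {x z : V} (h : x ∈ F.sub z) (hne : x ≠ z) :
    F.depth x ≠ 0 ∧ F.parent x ∈ F.sub z := by
  obtain ⟨i, hi⟩ := h
  refine ⟨fun h0 => hne ?_, ?_⟩
  · rw [← hi, Function.iterate_fixed (F.parent_root x h0)]
  · cases i with
    | zero => exact absurd hi hne
    | succ i => exact ⟨i, hi⟩

theorem root_eq_of_mem_sub {x z : V} (h : x ∈ F.sub z) : F.root x = F.root z := by
  obtain ⟨i, rfl⟩ := h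
  induction i with
  | zero => rfl
  | succ i ih => rw [Function.iterate_succ_apply', root_parent, ih]

theorem eq_of_mem_sub_of_depth_le {x z : V} (h : x ∈ F.sub z) (hd : F.depth x ≤ F.depth z) :
    x = z := by
  obtain ⟨i, rfl⟩ := h
  rw [depth_iterate] at hd
  rcases Nat.eq_zero_or_pos i with rfl | hi
  · rfl
  · have h0 : F.depth x = 0 := by omega
    rw [Function.iterate_fixed (F.parent_root x h0)]

theorem parent_notMem_sub {c : V} (hc : F.depth c ≠ 0) : F.parent c ∉ F.sub c := by
  intro h
  have h1 := F.depth_parent c hc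
  have h2 := F.eq_of_mem_sub_of_depth_le h (by omega)
  rw [h2] at h1
  omega

theorem mem_sub_or_mem_sub {x a b : V} (ha : x ∈ F.sub a) (hb : x ∈ F.sub b) :
    a ∈ F.sub b ∨ b ∈ F.sub a := by
  obtain ⟨i, rfl⟩ := ha
  obtain ⟨j, rfl⟩ := hb
  rcases le_total i j with h | h
  · left
    refine ⟨j - i, ?_⟩
    rw [← Function.iterate_add_apply, Nat.sub_add_cancel h]
  · right
    refine ⟨i - j, ?_⟩
    rw [← Function.iterate_add_apply, Nat.sub_add_cancel h]

theorem disjoint_sub_of_siblings {c c' : V} (hc : F.depth c ≠ 0) (hc' : F.depth c' ≠ 0)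
    (hp : F.parent c = F.parent c') (hne : c ≠ c') : Disjoint (F.sub c) (F.sub c') := by
  have hd : F.depth c = F.depth c' := by
    rw [← F.depth_parent c hc, ← F.depth_parent c' hc', hp]
  rw [Set.disjoint_left]
  intro x hx hx'
  rcases F.mem_sub_or_mem_sub hx hx' with h | h
  · exact hne (F.eq_of_mem_sub_of_depth_le h hd.le)
  · exact hne (F.eq_of_mem_sub_of_depth_le h hd.ge).symm

theorem exists_child_of_mem_sub {x z : V} (h : x ∈ F.sub z) (hne : x ≠ z) :
    ∃ c, F.depth c ≠ 0 ∧ F.parent c = z ∧ x ∈ F.sub c := by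
  obtain ⟨i, hi⟩ := h
  induction i generalizing x with
  | zero => exact absurd hi hne
  | succ i ih =>
    by_cases hpx : F.parent x = z
    · refine ⟨x, fun h0 => hne ?_, hpx, F.mem_sub_self x⟩
      rw [← hpx, F.parent_root x h0]
    · obtain ⟨c, h1, h2, h3⟩ := ih hpx hi
      exact ⟨c, h1, h2, F.mem_sub_of_parent_mem h3⟩

theorem mem_nbhd_of_mem_sub {x z : V} (h : x ∈ F.sub z) : x ∈ nbhd G k z := by
  rw [mem_nbhd_comm, mem_nbhd_iff]
  -- The bound is the depth and not `i`, since iterates may idle at a root.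
  suffices H : ∀ i x, F.parent^[i] x = z → ∃ p : G.Walk x z, p.length ≤ F.depth x by
    obtain ⟨i, hi⟩ := h
    obtain ⟨p, hp⟩ := H i x hi
    exact ⟨p, hp.trans (F.depth_le x)⟩
  intro i
  induction i with
  | zero =>
    rintro x rfl
    exact ⟨.nil, by simp⟩
  | succ i ih =>
    intro x hx
    obtain ⟨p, hp⟩ := ih (F.parent x) hx
    by_cases h0 : F.depth x = 0
    · rw [Function.iterate_succ_apply, F.parent_root x h0] at hx
      exact ih x hx
    · refine ⟨.cons (F.adj_parent x h0) p, ?_⟩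
      have := F.depth_parent x h0
      rw [SimpleGraph.Walk.length_cons]
      omega

theorem induce_connected_of_parent_mem {S : Set V} {z : V} (hz : z ∈ S)
    (hS : ∀ x ∈ S, x ≠ z → F.depth x ≠ 0 ∧ F.parent x ∈ S) : (G.induce S).Connected := by
  rw [SimpleGraph.connected_iff_exists_forall_reachable]
  refine ⟨⟨z, hz⟩, ?_⟩
  suffices H : ∀ n x (hx : x ∈ S), F.depth x = n →
      (G.induce S).Reachable ⟨z, hz⟩ ⟨x, hx⟩ from fun ⟨x, hx⟩ => H _ x hx rfl
  intro n
  induction n with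
  | zero =>
    intro x hx h0
    by_cases hxz : x = z
    · subst hxz
      rfl
    · exact absurd h0 (hS x hx hxz).1
  | succ n ih =>
    intro x hx hn
    by_cases hxz : x = z
    · subst hxz
      rfl
    · obtain ⟨h1, h2⟩ := hS x hx hxz
      have h3 := F.depth_parent x h1
      have hadj : (G.induce S).Adj ⟨F.parent x, h2⟩ ⟨x, hx⟩ := (F.adj_parent x h1).symm
      exact (ih _ h2 (by omega)).trans hadj.reachable

theorem induce_sub_connected (z : V) : (G.induce (F.sub z)).Connected :=
  F.induce_connected_of_parent_mem (F.mem_sub_self z) fun _ hx hne => F.parent_mem_sub hx hne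

theorem induce_cell_connected {m : V} (hm : F.depth m = 0) :
    (G.induce (F.root ⁻¹' {m})).Connected := by
  refine F.induce_connected_of_parent_mem (z := m) (F.root_eq_self hm) fun x hx hne => ?_
  refine ⟨fun h0 => hne ?_, (F.root_parent x).trans hx⟩
  rw [← F.root_eq_self h0]
  exact hx

/-- Removing a full subtree leaves a set closed under parents within the cell. It serves as the
connected set touched by exits that stay inside the cell. -/
theorem induce_cell_diff_sub_connected {z : V} (hz : F.depth z ≠ 0) :
    (G.induce (F.root ⁻¹' {F.root z} \ F.sub z)).Connected := by
  refine F.induce_connected_of_parent_mem (z := F.root z) ⟨F.root_eq_self (F.depth_root z), ?_⟩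
    fun x hx hne => ⟨fun h0 => hne ?_, (F.root_parent x).trans hx.1,
      fun h => hx.2 (F.mem_sub_of_parent_mem h)⟩
  · intro h
    have h1 := F.depth_root z
    have h2 := F.eq_of_mem_sub_of_depth_le h (by omega)
    rw [h2] at h1
    exact hz h1
  · rw [← F.root_eq_self h0]
    exact hx.1

/-- In a graph with no `K_{2,t}`-minor, fewer than `t` children of `z` have subtrees that touch a
given connected set. -/
theorem card_children_lt {t : ℕ} (hG : ¬ IsMinor (completeBipartiteGraph (Fin 2) (Fin t)) G)
    {z : V} {B : Set V} (hB : (G.induce B).Connected) (hzB : z ∉ B) (I : Finset V)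
    (hI : ∀ c ∈ I, F.depth c ≠ 0 ∧ F.parent c = z ∧ Disjoint (F.sub c) B ∧
      Touches G (F.sub c) B) : I.card < t := by
  refine card_lt_of_not_isMinor hG (induce_singleton_connected G z) hB
    (Set.disjoint_singleton_left.2 hzB) F.sub I (fun c _ => F.induce_sub_connected c) ?_ ?_
    (fun c hc => (hI c hc).2.2.1) ?_ (fun c hc => (hI c hc).2.2.2)
  · intro c hc c' hc' hne
    exact F.disjoint_sub_of_siblings (hI c hc).1 (hI c' hc').1
      ((hI c hc).2.1.trans (hI c' hc').2.1.symm) hne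
  · intro c hc
    rw [Set.disjoint_singleton_right, ← (hI c hc).2.1]
    exact F.parent_notMem_sub (hI c hc).1
  · intro c hc
    exact ⟨c, F.mem_sub_self c, z, rfl, (hI c hc).2.1 ▸ F.adj_parent c (hI c hc).1⟩

/-! ### Exits and the core -/

/-- The subtree of `c` is joined by an edge to a vertex outside the subtree of its parent. -/
def Exits (c : V) : Prop :=
  F.depth c ≠ 0 ∧ Touches G (F.sub c) (F.sub (F.parent c))ᶜ

/-- `c` and `c'` are siblings whose subtrees are joined by an edge. -/
def Linked (c c' : V) : Prop :=
  F.depth c ≠ 0 ∧ F.depth c' ≠ 0 ∧ F.parent c = F.parent c' ∧ c ≠ c' ∧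
    Touches G (F.sub c) (F.sub c')

/-- At most `j` steps between linked siblings lead from `c` to a sibling that exits. -/
def NearExit : ℕ → V → Prop
  | 0, c => F.Exits c
  | j + 1, c => NearExit j c ∨ ∃ c', NearExit j c' ∧ F.Linked c' c

theorem NearExit.mono {i j : ℕ} (hij : i ≤ j) {c : V} (h : F.NearExit i c) : F.NearExit j c := by
  induction hij with
  | refl => exact h
  | step _ ih => exact Or.inl ih

/-- While the walk stays below `z` and avoids `z`, each step remains in one child subtree or crosses
between linked siblings; the step leaving the subtree of `z` witnesses an exit. -/
theorem nearExit_of_walk {z w x : V} (p : G.Walk w x) (hx : x ∉ F.sub z) (hz : z ∉ p.support)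
    {c : V} (hc : F.depth c ≠ 0) (hcz : F.parent c = z) (hw : w ∈ F.sub c) :
    F.NearExit p.length c := by
  induction p generalizing c with
  | nil =>
    exact absurd (hcz ▸ F.sub_subset_sub_parent c hw) hx
  | @cons w y x h q ih =>
    rw [SimpleGraph.Walk.length_cons]
    rw [SimpleGraph.Walk.support_cons, List.mem_cons, not_or] at hz
    by_cases hy : y ∈ F.sub z
    · have hyz : y ≠ z := by
        rintro rfl
        exact hz.2 q.start_mem_support
      obtain ⟨c', h1, h2, h3⟩ := F.exists_child_of_mem_sub hy hyz
      have hc' := ih hx hz.2 h1 h2 h3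
      by_cases hcc : c' = c
      · exact Or.inl (hcc ▸ hc')
      · exact Or.inr ⟨c', hc', h1, hc, h2.trans hcz.symm, hcc, y, h3, w, hw, h.symm⟩
    · exact NearExit.mono F (Nat.zero_le _)
        (show F.Exits c from ⟨hc, w, hw, y, hcz.symm ▸ hy, h⟩)

theorem nbhd_subset_of_not_nearExit {c w : V} (hc : F.depth c ≠ 0) (hcn : ¬ F.NearExit k c)
    (hw : w ∈ F.sub c) : nbhd G k w ⊆ nbhd G k (F.parent c) := by
  classical
  intro x hx
  by_cases hxz : x ∈ F.sub (F.parent c)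
  · exact F.mem_nbhd_of_mem_sub hxz
  obtain ⟨p, hp⟩ := mem_nbhd_iff.1 hx
  by_cases hz : F.parent c ∈ p.support
  · exact mem_nbhd_iff.2 ⟨p.dropUntil _ hz, (p.length_dropUntil_le_length hz).trans hp⟩
  · exact absurd (NearExit.mono F hp (F.nearExit_of_walk p hxz hz hc rfl hw)) hcn

/-- The `i`-th stage of the core: start with the roots and repeatedly add the children that are
near an exit. -/
def Core : ℕ → V → Prop
  | 0, v => F.depth v = 0
  | i + 1, v => Core i v ∨ (F.NearExit k v ∧ Core i (F.parent v))

theorem Core.mono {i j : ℕ} (hij : i ≤ j) {v : V} (h : F.Core i v) : F.Core j v := by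
  induction hij with
  | refl => exact h
  | step _ ih => exact Or.inl ih

/-- Every ball of radius `k` is contained in one whose centre lies in the core. -/
theorem exists_core_nbhd_subset (w : V) :
    ∃ z, F.Core k z ∧ nbhd G k w ⊆ nbhd G k z := by
  classical
  by_contra! hcon
  -- If no core ball contained that of `w`, no ancestor of `w` could fail to be near an exit, so the
  -- core would extend from the root down to `w`, whose own ball then does the job.
  have key : ∀ n x, F.depth x = n → w ∈ F.sub x → F.Core n x := by
    intro n
    induction n with
    | zero => exact fun x hx _ => hx
    | succ n ih =>
      intro x hx hw
      have hd := F.depth_parent x (by omega)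
      have hpar := ih (F.parent x) (by omega) (F.sub_subset_sub_parent x hw)
      refine Or.inr ⟨?_, hpar⟩
      by_contra hne
      exact hcon _ (Core.mono F (by have := F.depth_le x; omega) hpar)
        (F.nbhd_subset_of_not_nearExit (by omega) hne hw)
  exact hcon w (Core.mono F (F.depth_le w) (key _ w rfl (F.mem_sub_self w))) subset_rfl

end RootedForest

namespace RootedForest

/-! ### Counting the core -/

section Counting

variable {V : Type u} [Fintype V] {G : SimpleGraph V} {k : ℕ} (F : RootedForest G k)

open Classical in
/-- The roots of the forest. -/
noncomputable def roots : Finset V :=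
  Finset.univ.filter fun v => F.depth v = 0

open Classical in
/-- Pairs `(c, m)` with `c` of depth at most `i` whose subtree touches the cell of another
root `m`. -/
noncomputable def cellContacts (i : ℕ) : Finset (V × V) :=
  Finset.univ.filter fun e =>
    F.depth e.1 ≤ i ∧ e.2 ≠ F.root e.1 ∧ Touches G (F.sub e.1) (F.root ⁻¹' {e.2})

open Classical in
/-- The children of vertices of `S` that are within `j` sibling steps of an exit. -/
noncomputable def nearExitChildren (j : ℕ) (S : Finset V) : Finset V :=
  Finset.univ.filter fun c => F.NearExit j c ∧ F.parent c ∈ S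

open Classical in
/-- The `i`-th stage of the core as a finset. -/
noncomputable def coreFinset (i : ℕ) : Finset V :=
  Finset.univ.filter fun v => F.Core i v

theorem mem_cellContacts {i : ℕ} {c m : V} : (c, m) ∈ F.cellContacts i ↔
    F.depth c ≤ i ∧ m ≠ F.root c ∧ Touches G (F.sub c) (F.root ⁻¹' {m}) := by
  simp [cellContacts]

variable {t : ℕ}

/-- The subtree of a root is its cell, so these are adjacent pairs in the graph of contracted cells.
-/
theorem card_cellContacts_zero_le
    (hG : ¬ IsMinor (completeBipartiteGraph (Fin 2) (Fin t)) G) :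
    (F.cellContacts 0).card ≤ 2 * t * F.roots.card := by
  classical
  have h1 : F.cellContacts 0 ⊆ adjFibres G F.root := by
    rintro ⟨c, m⟩ h
    obtain ⟨hc, hm, x, hx, y, hy, hxy⟩ := F.mem_cellContacts.1 h
    have hcr := F.root_eq_self (Nat.le_zero.1 hc)
    rw [hcr] at hm
    exact mem_adjFibres.2 ⟨hm.symm, x, (F.root_eq_of_mem_sub hx).trans hcr, y, hy, hxy⟩
  have h2 : Finset.univ.image F.root ⊆ F.roots := by
    intro x hx
    obtain ⟨v, -, rfl⟩ := Finset.mem_image.1 hx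
    simp [roots, F.depth_root]
  calc (F.cellContacts 0).card ≤ (adjFibres G F.root).card := Finset.card_le_card h1
    _ ≤ 2 * t * (Finset.univ.image F.root).card :=
      card_adjFibres_le hG F.root fun v => F.induce_cell_connected (F.depth_root v)
    _ ≤ 2 * t * F.roots.card := Nat.mul_le_mul_left _ (Finset.card_le_card h2)

/-- A contact of `c` is also a contact of its parent, and fewer than `t` children of `z` touch the
connected cell of `m`. -/
theorem card_cellContacts_succ_le
    (hG : ¬ IsMinor (completeBipartiteGraph (Fin 2) (Fin t)) G) (i : ℕ) :
    (F.cellContacts (i + 1)).card ≤ t * (F.cellContacts i).card := by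
  classical
  refine Finset.card_le_mul_card_image_of_maps_to (f := fun e => (F.parent e.1, e.2)) ?_ t ?_
  · rintro ⟨c, m⟩ h
    obtain ⟨hc, hm, x, hx, hT⟩ := F.mem_cellContacts.1 h
    refine F.mem_cellContacts.2 ⟨?_, ?_, x, F.sub_subset_sub_parent c hx, hT⟩
    · exact (F.depth_parent_eq c).trans_le (by omega)
    · rwa [F.root_parent]
  · rintro ⟨z, m⟩ hzm
    obtain ⟨-, hm, x, -, y, hy, -⟩ := F.mem_cellContacts.1 hzm
    have hroot : F.depth m = 0 := by
      rw [← show F.root y = m from hy]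
      exact F.depth_root y
    let I : Finset V := Finset.univ.filter fun c =>
      F.depth c ≠ 0 ∧ F.parent c = z ∧ Touches G (F.sub c) (F.root ⁻¹' {m})
    have hI : I.card < t := by
      refine F.card_children_lt hG (F.induce_cell_connected hroot) (z := z)
        (fun h => hm (Eq.symm h)) I fun c hc => ?_
      obtain ⟨h1, h2, h3⟩ := (Finset.mem_filter.1 hc).2
      refine ⟨h1, h2, ?_, h3⟩
      rw [Set.disjoint_left]
      intro v hv hvm
      apply hm
      rw [← h2, F.root_parent, ← F.root_eq_of_mem_sub hv]
      exact hvm.symm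
    -- A root `z` is its own parent, so it can lie in its own fibre; this extra element turns `< t`
    -- into `≤ t`.
    have hsub : (F.cellContacts (i + 1)).filter (fun e => (F.parent e.1, e.2) = (z, m)) ⊆
        (insert z I).image fun c => (c, m) := by
      rintro ⟨c, m'⟩ h
      obtain ⟨h1, h2⟩ := Finset.mem_filter.1 h
      obtain ⟨hcz, rfl⟩ := Prod.mk.inj h2
      obtain ⟨-, -, hT⟩ := F.mem_cellContacts.1 h1
      refine Finset.mem_image.2 ⟨c, ?_, rfl⟩
      by_cases h0 : F.depth c = 0
      · rw [← hcz, F.parent_root c h0]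
        exact Finset.mem_insert_self _ _
      · exact Finset.mem_insert_of_mem (by simp [I, h0, hcz, hT])
    calc _ ≤ _ := Finset.card_le_card hsub
      _ ≤ (insert z I).card := Finset.card_image_le
      _ ≤ I.card + 1 := Finset.card_insert_le _ _
      _ ≤ t := hI

theorem card_cellContacts_le
    (hG : ¬ IsMinor (completeBipartiteGraph (Fin 2) (Fin t)) G) (i : ℕ) :
    (F.cellContacts i).card ≤ t ^ i * (2 * t) * F.roots.card := by
  induction i with
  | zero => simpa using F.card_cellContacts_zero_le hG
  | succ i ih =>
    calc (F.cellContacts (i + 1)).card ≤ t * (F.cellContacts i).card :=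
        F.card_cellContacts_succ_le hG i
      _ ≤ t * (t ^ i * (2 * t) * F.roots.card) := Nat.mul_le_mul_left _ ih
      _ = t ^ (i + 1) * (2 * t) * F.roots.card := by ring

/-- An exit leads either to another cell, which is a cell contact, or to the rest of the same cell,
which is connected and so is touched by fewer than `t` child subtrees of each vertex of `S`. -/
theorem card_nearExitChildren_zero_le
    (hG : ¬ IsMinor (completeBipartiteGraph (Fin 2) (Fin t)) G) (S : Finset V) :
    (F.nearExitChildren 0 S).card ≤ (F.cellContacts k).card + t * S.card := by
  classical
  let X : Finset V := Finset.univ.filter fun c =>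
    (F.depth c ≠ 0 ∧ F.depth (F.parent c) ≠ 0 ∧
      Touches G (F.sub c) (F.root ⁻¹' {F.root (F.parent c)} \ F.sub (F.parent c))) ∧
      F.parent c ∈ S
  have hX : X.card ≤ t * S.card := by
    refine Finset.card_le_mul_card_image_of_maps_to (f := F.parent)
      (fun c hc => (Finset.mem_filter.1 hc).2.2) t fun z _ => ?_
    rcases (X.filter fun c => F.parent c = z).eq_empty_or_nonempty with h | ⟨c₀, hc₀⟩
    · simp [h]
    obtain ⟨h₀, rfl⟩ := Finset.mem_filter.1 hc₀
    have hz := (Finset.mem_filter.1 h₀).2.1.2.1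
    refine (F.card_children_lt hG (F.induce_cell_diff_sub_connected hz)
      (fun h => h.2 (F.mem_sub_self _)) _ fun c hc => ?_).le
    obtain ⟨h1, h2⟩ := Finset.mem_filter.1 hc
    obtain ⟨⟨h3, -, h4⟩, -⟩ := (Finset.mem_filter.1 h1).2
    rw [h2] at h4
    refine ⟨h3, h2, ?_, h4⟩
    rw [Set.disjoint_left]
    intro v hv hv'
    exact hv'.2 (h2 ▸ F.sub_subset_sub_parent c hv)
  have hsub : F.nearExitChildren 0 S ⊆ (F.cellContacts k).image Prod.fst ∪ X := by
    intro c hc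
    obtain ⟨⟨hd, x, hx, y, hy, hxy⟩, hS⟩ := (Finset.mem_filter.1 hc).2
    rw [Finset.mem_union]
    by_cases hr : F.root y = F.root c
    · right
      have hr' : F.root y = F.root (F.parent c) := by rw [hr, F.root_parent]
      -- If the parent were a root, its subtree would be the whole cell and nothing could exit
      -- within the cell.
      refine Finset.mem_filter.2 ⟨Finset.mem_univ _, ⟨hd, fun h0 => hy ?_, x, hx, y,
        ⟨hr', hy⟩, hxy⟩, hS⟩
      rw [← F.root_eq_self h0, ← hr']
      exact F.mem_sub_root y
    · left
      exact Finset.mem_image.2 ⟨(c, F.root y),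
        F.mem_cellContacts.2 ⟨F.depth_le c, hr, x, hx, y, rfl, hxy⟩, rfl⟩
  calc _ ≤ _ := Finset.card_le_card hsub
    _ ≤ ((F.cellContacts k).image Prod.fst).card + X.card := Finset.card_union_le _ _
    _ ≤ _ := Nat.add_le_add Finset.card_image_le hX

/-- The subtree of `c` is itself a connected set avoiding the parent, so `c` has at most `t` linked
siblings. -/
theorem card_nearExitChildren_succ_le
    (hG : ¬ IsMinor (completeBipartiteGraph (Fin 2) (Fin t)) G) (j : ℕ) (S : Finset V) :
    (F.nearExitChildren (j + 1) S).card ≤ (t + 1) * (F.nearExitChildren j S).card := by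
  classical
  have hlinked : ∀ c, (Finset.univ.filter fun c' => F.Linked c c').card ≤ t := by
    intro c
    rcases (Finset.univ.filter fun c' => F.Linked c c').eq_empty_or_nonempty with h | ⟨c₀, hc₀⟩
    · simp [h]
    have hc := (Finset.mem_filter.1 hc₀).2.1
    refine (F.card_children_lt hG (F.induce_sub_connected c) (F.parent_notMem_sub hc) _
      fun c' hc' => ?_).le
    obtain ⟨-, h1, h2, h3, h4⟩ := (Finset.mem_filter.1 hc').2
    exact ⟨h1, h2.symm, (F.disjoint_sub_of_siblings hc h1 h2 h3).symm, h4.symm⟩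
  have hsub : F.nearExitChildren (j + 1) S ⊆ F.nearExitChildren j S ∪
      (F.nearExitChildren j S).biUnion fun c => Finset.univ.filter fun c' => F.Linked c c' := by
    intro c hc
    obtain ⟨h, hS⟩ := (Finset.mem_filter.1 hc).2
    rw [Finset.mem_union]
    rcases h with h | ⟨c', h, hl⟩
    · exact Or.inl (Finset.mem_filter.2 ⟨Finset.mem_univ _, h, hS⟩)
    · refine Or.inr (Finset.mem_biUnion.2 ⟨c', ?_, by simpa using hl⟩)
      exact Finset.mem_filter.2 ⟨Finset.mem_univ _, h, hl.2.2.1 ▸ hS⟩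
  calc _ ≤ _ := Finset.card_le_card hsub
    _ ≤ _ := Finset.card_union_le _ _
    _ ≤ (F.nearExitChildren j S).card + (F.nearExitChildren j S).card * t :=
      Nat.add_le_add_left (Finset.card_biUnion_le_card_mul _ _ _ fun c _ => hlinked c) _
    _ = _ := by ring

theorem card_nearExitChildren_le
    (hG : ¬ IsMinor (completeBipartiteGraph (Fin 2) (Fin t)) G) (j : ℕ) (S : Finset V) :
    (F.nearExitChildren j S).card ≤
      (t + 1) ^ j * (t ^ k * (2 * t) * F.roots.card + t * S.card) := by
  induction j with
  | zero =>
    simpa using (F.card_nearExitChildren_zero_le hG S).trans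
      (Nat.add_le_add_right (F.card_cellContacts_le hG k) _)
  | succ j ih =>
    calc _ ≤ _ := F.card_nearExitChildren_succ_le hG j S
      _ ≤ _ := Nat.mul_le_mul_left _ ih
      _ = _ := by ring

end Counting

/-- Bound on the size of the `i`-th stage of the core, relative to the number of roots. -/
def coreBound (t k : ℕ) : ℕ → ℕ
  | 0 => 1
  | i + 1 => coreBound t k i + (t + 1) ^ k * (t ^ k * (2 * t) + t * coreBound t k i)

theorem card_coreFinset_le {V : Type u} [Fintype V] {G : SimpleGraph V} {k t : ℕ}
    (F : RootedForest G k) (hG : ¬ IsMinor (completeBipartiteGraph (Fin 2) (Fin t)) G) (i : ℕ) :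
    (F.coreFinset i).card ≤ coreBound t k i * F.roots.card := by
  classical
  induction i with
  | zero =>
    rw [coreBound, one_mul]
    exact Finset.card_le_card fun v hv =>
      Finset.mem_filter.2 ⟨Finset.mem_univ _, (Finset.mem_filter.1 hv).2⟩
  | succ i ih =>
    have hsub : F.coreFinset (i + 1) ⊆
        F.coreFinset i ∪ F.nearExitChildren k (F.coreFinset i) := by
      intro v hv
      rw [Finset.mem_union]
      rcases (Finset.mem_filter.1 hv).2 with h | ⟨h1, h2⟩
      · exact Or.inl (Finset.mem_filter.2 ⟨Finset.mem_univ _, h⟩)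
      · exact Or.inr (Finset.mem_filter.2 ⟨Finset.mem_univ _, h1,
          Finset.mem_filter.2 ⟨Finset.mem_univ _, h2⟩⟩)
    calc (F.coreFinset (i + 1)).card ≤ _ := Finset.card_le_card hsub
      _ ≤ _ := Finset.card_union_le _ _
      _ ≤ (F.coreFinset i).card + (t + 1) ^ k *
          (t ^ k * (2 * t) * F.roots.card + t * (F.coreFinset i).card) :=
        Nat.add_le_add_left (F.card_nearExitChildren_le hG k _) _
      _ ≤ coreBound t k i * F.roots.card + (t + 1) ^ k *
          (t ^ k * (2 * t) * F.roots.card + t * (coreBound t k i * F.roots.card)) := by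
        gcongr
      _ = coreBound t k (i + 1) * F.roots.card := by
        rw [coreBound]
        ring

end RootedForest

/-! ### From the core to the approximation ratio -/

section Approximation

variable {V : Type u}

theorem isDistDominating_domSet [Finite V] (G : SimpleGraph V) (ID : V → ℕ)
    (hID : Function.Injective ID) (k : ℕ) : IsDistDominating G k (domSet G ID k) := by
  intro v
  obtain ⟨w, hw, -⟩ := existsUnique_selects G ID hID k v
  exact ⟨w, ⟨v, hw⟩, hw.1⟩

theorem exists_isDistDominating_ncard_eq (G : SimpleGraph V) (k : ℕ) :
    ∃ M : Set V, IsDistDominating G k M ∧ M.ncard = distDomNumber G k := by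
  have hne : {n | ∃ D : Set V, IsDistDominating G k D ∧ D.ncard = n}.Nonempty :=
    ⟨_, Set.univ, fun v => ⟨v, trivial, by simp [nbhd]⟩, rfl⟩
  exact Nat.sInf_mem hne

/-- If a selected ball is contained in another one, the two balls agree. -/
theorem Selects.nbhd_eq_of_subset [Finite V] {G : SimpleGraph V} {ID : V → ℕ} {k : ℕ} {v w z : V}
    (h : Selects G ID k v w) (hz : nbhd G k w ⊆ nbhd G k z) : nbhd G k w = nbhd G k z := by
  -- By symmetry of balls `v ∈ N^k[w] ⊆ N^k[z]`, so `z` was a candidate for `v`.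
  have hzv : z ∈ nbhd G k v := mem_nbhd_comm.1 (hz (mem_nbhd_comm.1 h.1))
  refine Set.eq_of_subset_of_ncard_le hz ?_ (Set.toFinite _)
  have := h.2 z hzv
  simp only [ballCard] at this
  omega

theorem Selects.id_le_of_nbhd_eq {G : SimpleGraph V} {ID : V → ℕ} {k : ℕ} {v w w' : V}
    (h : Selects G ID k v w) (hww : nbhd G k w = nbhd G k w') : ID w' ≤ ID w := by
  have hv : w' ∈ nbhd G k v := mem_nbhd_comm.1 (hww ▸ mem_nbhd_comm.1 h.1)
  have := h.2 w' hv
  simp only [ballCard, hww] at this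
  omega

/-- If every ball is contained in a ball with centre in `R`, then DomSet selects at most `|R|`
vertices. -/
theorem ncard_domSet_le_of_nbhd_subset [Finite V] {G : SimpleGraph V} {ID : V → ℕ}
    (hID : Function.Injective ID) {k : ℕ} {R : Set V}
    (hR : ∀ w, ∃ z ∈ R, nbhd G k w ⊆ nbhd G k z) : (domSet G ID k).ncard ≤ R.ncard := by
  choose g hgR hg using hR
  refine Set.ncard_le_ncard_of_injOn g (fun w _ => hgR w) ?_ (Set.toFinite _)
  rintro w ⟨v, hv⟩ w' ⟨v', hv'⟩ hgw
  have h1 := hv.nbhd_eq_of_subset (hg w)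
  have h2 := hv'.nbhd_eq_of_subset (hg w')
  have h3 : nbhd G k w = nbhd G k w' := by rw [h1, h2, hgw]
  exact hID (le_antisymm (hv'.id_le_of_nbhd_eq h3.symm) (hv.id_le_of_nbhd_eq h3))

theorem ncard_domSet_le [Finite V] {G : SimpleGraph V} {ID : V → ℕ}
    (hID : Function.Injective ID) {t k : ℕ}
    (hG : ¬ IsMinor (completeBipartiteGraph (Fin 2) (Fin t)) G) :
    (domSet G ID k).ncard ≤ RootedForest.coreBound t k k * distDomNumber G k := by
  have := Fintype.ofFinite V
  obtain ⟨M, hM, hcard⟩ := exists_isDistDominating_ncard_eq G k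
  obtain ⟨F, hF⟩ := exists_rootedForest hM
  have hroots : F.roots.card ≤ distDomNumber G k := by
    rw [← hcard, ← Set.ncard_coe_finset]
    exact Set.ncard_le_ncard (fun v hv => hF v (Finset.mem_filter.1 hv).2) (Set.toFinite _)
  calc (domSet G ID k).ncard ≤ (F.coreFinset k : Set V).ncard := by
        refine ncard_domSet_le_of_nbhd_subset hID fun w => ?_
        obtain ⟨z, hz, hwz⟩ := F.exists_core_nbhd_subset w
        exact ⟨z, by simpa [RootedForest.coreFinset] using hz, hwz⟩
    _ = (F.coreFinset k).card := Set.ncard_coe_finset _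
    _ ≤ _ := F.card_coreFinset_le hG k
    _ ≤ _ := Nat.mul_le_mul_left _ hroots

end Approximation

/-! ### The LOCAL implementation -/

section View

/-- The graph on identifiers spanned by a set of known edges. -/
def viewGraph (K : Set (ℕ × ℕ)) : SimpleGraph ℕ :=
  SimpleGraph.fromRel fun a b => (a, b) ∈ K

open Classical in
/-- The result of running DomSet on the known part of the network. -/
noncomputable def viewOutput (k i : ℕ) (K : Set (ℕ × ℕ)) : DomSetOutput where
  q := ballCard (viewGraph K) k i
  -- The set is a singleton once `3 * k` rounds have passed; `sInf` merely extracts its element.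
  selected := sInf {n | Selects (viewGraph K) id k i n}
  inD := decide (i ∈ domSet (viewGraph K) id k)

/-- DomSet in the LOCAL model. A state consists of a round counter, the own identifier and the set
of edges known so far. For `3 * k` rounds every vertex sends all edges it knows to its neighbours;
then it evaluates DomSet on the part of the network it has seen. -/
noncomputable def domSetAlgorithm (k : ℕ) : LocalAlgorithm DomSetOutput where
  State := ℕ × ℕ × Set (ℕ × ℕ)
  Msg := Set (ℕ × ℕ)
  init i := (0, i, ∅)
  send s _ := s.2.2
  receive s ms := (s.1 + 1, s.2.1, s.2.2 ∪ {e | ∃ m ∈ ms, e = (s.2.1, m.1) ∨ e ∈ m.2})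
  output s := if s.1 < 3 * k then none else some (viewOutput k s.2.1 s.2.2)

variable {V : Type u} {G : SimpleGraph V} {ID : V → ℕ}

/-- The edges known to `v` after `r` rounds: those starting at distance less than `r`. -/
def knownEdges (G : SimpleGraph V) (ID : V → ℕ) (r : ℕ) (v : V) : Set (ℕ × ℕ) :=
  {e | ∃ x y, G.Adj x y ∧ e = (ID x, ID y) ∧ ∃ p : G.Walk v x, p.length < r}

/-- Split a walk from `v` at its first step: the edges at `v` are learnt from sender labels, all
others from the message of the next vertex on the walk. -/
theorem run_domSetAlgorithm (k r : ℕ) (v : V) :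
    (domSetAlgorithm k).run G ID r v = (r, ID v, knownEdges G ID r v) := by
  induction r generalizing v with
  | zero =>
    have : knownEdges G ID 0 v = ∅ := by simp [knownEdges]
    rw [this]
    rfl
  | succ r ih =>
    simp only [LocalAlgorithm.run, ih]
    refine Prod.ext rfl (Prod.ext rfl ?_)
    change knownEdges G ID r v ∪ {e | ∃ m ∈ {m : ℕ × Set (ℕ × ℕ) |
      ∃ x, G.Adj v x ∧ m = (ID x, knownEdges G ID r x)}, e = (ID v, m.1) ∨ e ∈ m.2} =
        knownEdges G ID (r + 1) v
    ext e
    constructor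
    · rintro (⟨x, y, hxy, he, p, hp⟩ | ⟨_, ⟨y, hy, rfl⟩, rfl | ⟨x, z, hxz, he, p, hp⟩⟩)
      · exact ⟨x, y, hxy, he, p, by omega⟩
      · exact ⟨v, y, hy, rfl, .nil, by simp⟩
      · exact ⟨x, z, hxz, he, .cons hy p, by simpa using hp⟩
    · rintro ⟨x, y, hxy, he, p, hp⟩
      cases p with
      | nil => exact Or.inr ⟨_, ⟨y, hxy, rfl⟩, Or.inl he⟩
      | @cons _ z _ h q =>
        exact Or.inr ⟨_, ⟨z, h, rfl⟩, Or.inr ⟨x, y, hxy, he, q, by simpa using hp⟩⟩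

variable (G ID) in
/-- What `v` sees of the network after `r` rounds. -/
def view (r : ℕ) (v : V) : SimpleGraph ℕ :=
  viewGraph (knownEdges G ID r v)

theorem exists_adj_of_view_adj {r : ℕ} {v : V} {a b : ℕ} (h : (view G ID r v).Adj a b) :
    ∃ x y, G.Adj x y ∧ ID x = a ∧ ID y = b := by
  rcases h with ⟨-, ⟨x, y, hxy, he, -⟩ | ⟨x, y, hxy, he, -⟩⟩
  · obtain ⟨rfl, rfl⟩ := Prod.mk.inj he
    exact ⟨x, y, hxy, rfl, rfl⟩
  · obtain ⟨rfl, rfl⟩ := Prod.mk.inj he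
    exact ⟨y, x, hxy.symm, rfl, rfl⟩

theorem view_adj (hID : Function.Injective ID) {r : ℕ} {v x y : V} (p : G.Walk v x)
    (hp : p.length < r) (hxy : G.Adj x y) : (view G ID r v).Adj (ID x) (ID y) :=
  ⟨fun h => hxy.ne (hID h), Or.inl ⟨x, y, hxy, rfl, p, hp⟩⟩

theorem exists_walk_of_view_walk (hID : Function.Injective ID) {r : ℕ} {v : V} {a b : ℕ}
    (p : (view G ID r v).Walk a b) {x : V} (hx : ID x = a) :
    ∃ y, ID y = b ∧ ∃ q : G.Walk x y, q.length = p.length := by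
  induction p generalizing x with
  | nil => exact ⟨x, hx, .nil, rfl⟩
  | cons h p ih =>
    obtain ⟨x', y, hxy, hx', hy⟩ := exists_adj_of_view_adj h
    obtain rfl := hID (hx.trans hx'.symm)
    obtain ⟨z, hz, q, hq⟩ := ih hy
    exact ⟨z, hz, .cons hxy q, by simp [hq]⟩

theorem exists_view_walk (hID : Function.Injective ID) {r : ℕ} {v x y : V} (q : G.Walk x y)
    (p : G.Walk v x) (h : p.length + q.length ≤ r) :
    ∃ p' : (view G ID r v).Walk (ID x) (ID y), p'.length = q.length := by
  induction q with
  | nil => exact ⟨.nil, rfl⟩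
  | cons hxy q ih =>
    rw [SimpleGraph.Walk.length_cons] at h
    obtain ⟨p', hp'⟩ := ih (p.concat hxy) (by rw [SimpleGraph.Walk.length_concat]; omega)
    exact ⟨.cons (view_adj hID p (by omega) hxy) p', by simp [hp']⟩

/-- A walk of length at most `j` from `x` uses only edges starting at distance less than `n + j`
from `v`, all of them known; conversely every known edge is real, so walks in the view lift to `G`.
-/
theorem nbhd_view (hID : Function.Injective ID) {r n j : ℕ} {v x : V} (hx : x ∈ nbhd G n v)
    (h : n + j ≤ r) : nbhd (view G ID r v) j (ID x) = ID '' nbhd G j x := by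
  obtain ⟨p, hp⟩ := mem_nbhd_iff.1 hx
  ext b
  constructor
  · intro hb
    obtain ⟨q, hq⟩ := mem_nbhd_iff.1 hb
    obtain ⟨y, rfl, q', hq'⟩ := exists_walk_of_view_walk hID q rfl
    exact ⟨y, mem_nbhd_iff.2 ⟨q', hq'.trans_le hq⟩, rfl⟩
  · rintro ⟨y, hy, rfl⟩
    obtain ⟨q, hq⟩ := mem_nbhd_iff.1 hy
    obtain ⟨q', hq'⟩ := exists_view_walk hID q p (r := r) (by omega)
    exact mem_nbhd_iff.2 ⟨q', hq'.trans_le hq⟩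

theorem ballCard_view (hID : Function.Injective ID) {r n j : ℕ} {v x : V} (hx : x ∈ nbhd G n v)
    (h : n + j ≤ r) : ballCard (view G ID r v) j (ID x) = ballCard G j x := by
  rw [ballCard, nbhd_view hID hx h, Set.ncard_image_of_injective _ hID, ballCard]

theorem mem_nbhd_trans {m n : ℕ} {u v w : V} (huv : v ∈ nbhd G m u) (hvw : w ∈ nbhd G n v) :
    w ∈ nbhd G (m + n) u := by
  obtain ⟨p, hp⟩ := mem_nbhd_iff.1 huv
  obtain ⟨q, hq⟩ := mem_nbhd_iff.1 hvw
  exact mem_nbhd_iff.2 ⟨p.append q, by rw [SimpleGraph.Walk.length_append]; omega⟩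

/-- Candidates of `x` lie within `2 * k` of `v` and their balls within `3 * k`, so all compared
cardinalities are seen correctly. -/
theorem selects_view_iff (hID : Function.Injective ID) {k : ℕ} {v x : V} (hx : x ∈ nbhd G k v)
    {b : ℕ} : Selects (view G ID (3 * k) v) id k (ID x) b ↔ ∃ w, Selects G ID k x w ∧ b = ID w := by
  have hball : ∀ y ∈ nbhd G k x,
      ballCard (view G ID (3 * k) v) k (ID y) = ballCard G k y := fun y hy =>
    ballCard_view hID (mem_nbhd_trans hx hy) (by omega)
  have hn : nbhd (view G ID (3 * k) v) k (ID x) = ID '' nbhd G k x :=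
    nbhd_view hID hx (by omega)
  rw [Selects, hn]
  constructor
  · rintro ⟨⟨w, hw, rfl⟩, h⟩
    refine ⟨w, ⟨hw, fun y hy => ?_⟩, rfl⟩
    simpa [hball y hy, hball w hw] using h (ID y) ⟨y, hy, rfl⟩
  · rintro ⟨w, ⟨hw, h⟩, rfl⟩
    refine ⟨⟨w, hw, rfl⟩, ?_⟩
    rintro _ ⟨y, hy, rfl⟩
    simpa [hball y hy, hball w hw] using h y hy

theorem self_mem_nbhd (G : SimpleGraph V) (k : ℕ) (v : V) : v ∈ nbhd G k v := by
  simp [nbhd]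

theorem mem_domSet_view_iff (hID : Function.Injective ID) (k : ℕ) (v : V) :
    ID v ∈ domSet (view G ID (3 * k) v) id k ↔ v ∈ domSet G ID k := by
  constructor
  · rintro ⟨a, ha⟩
    have hmem := mem_nbhd_comm.1 ha.1
    -- The view lives on all of `ℕ`; this shows that the selecting identifier belongs to an actual
    -- vertex near `v`.
    rw [nbhd_view hID (self_mem_nbhd G 0 v) (by omega)] at hmem
    obtain ⟨x, hx, rfl⟩ := hmem
    obtain ⟨w, hw, hvw⟩ := (selects_view_iff hID hx).1 ha
    exact ⟨x, hID hvw ▸ hw⟩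
  · rintro ⟨x, hx⟩
    exact ⟨ID x, (selects_view_iff hID (mem_nbhd_comm.1 hx.1)).2 ⟨v, hx, rfl⟩⟩

theorem isDomSetOutput_viewOutput [Finite V] (hID : Function.Injective ID) (k : ℕ) (v : V) :
    IsDomSetOutput G ID k v (viewOutput k (ID v) (knownEdges G ID (3 * k) v)) := by
  obtain ⟨w, hw, huniq⟩ := existsUnique_selects G ID hID k v
  have hset : {n | Selects (view G ID (3 * k) v) id k (ID v) n} = {ID w} := by
    ext n
    rw [Set.mem_ofPred_eq, selects_view_iff hID (self_mem_nbhd G k v), Set.mem_singleton_iff]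
    constructor
    · rintro ⟨w', hw', rfl⟩
      rw [huniq w' hw']
    · rintro rfl
      exact ⟨w, hw, rfl⟩
  refine ⟨ballCard_view hID (self_mem_nbhd G 0 v) (by omega), ⟨w, hw, ?_⟩, ?_⟩
  · change sInf {n | Selects (view G ID (3 * k) v) id k (ID v) n} = ID w
    rw [hset, csInf_singleton]
  · rw [← mem_domSet_view_iff hID]
    simp only [viewOutput, decide_eq_true_eq]
    rfl

theorem solvesWithin_domSetAlgorithm [Finite V] (hID : Function.Injective ID) (k : ℕ) :
    (domSetAlgorithm k).SolvesWithin G ID (3 * k) (IsDomSetOutput G ID k) := by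
  intro v
  refine ⟨3 * k, le_rfl, fun s hs => ?_, _, ?_, isDomSetOutput_viewOutput hID k v⟩
  · rw [run_domSetAlgorithm]
    exact if_pos hs
  · rw [run_domSetAlgorithm]
    exact if_neg (lt_irrefl _)

end View

end DistDom

theorem mainTheorem1 :
    ∃ (c : ℕ) (DomSet : ℕ → DistDom.LocalAlgorithm DistDom.DomSetOutput),
      ∀ t k : ℕ, 1 ≤ t → 1 ≤ k → ∃ δ : ℕ,
        ∀ (V : Type u) [Finite V] (G : SimpleGraph V) (ID : V → ℕ), Function.Injective ID →
          G.Connected →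
          ¬ DistDom.IsMinor (completeBipartiteGraph (Fin 2) (Fin t)) G →
          4 * k ≤ G.diam →
            (DomSet k).SolvesWithin G ID (c * k) (DistDom.IsDomSetOutput G ID k) ∧
            DistDom.IsDistDominating G k (DistDom.domSet G ID k) ∧
            (DistDom.domSet G ID k).ncard ≤ δ * DistDom.distDomNumber G k := by
  refine ⟨3, DistDom.domSetAlgorithm, fun t k _ _ => ⟨DistDom.RootedForest.coreBound t k k, ?_⟩⟩
  intro V _ G ID hID _ hG _
  exact ⟨DistDom.solvesWithin_domSetAlgorithm hID k,
    DistDom.isDistDominating_domSet G ID hID k, DistDom.ncard_domSet_le hID hG⟩
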